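/- Let $(A_n,B_n)_{n\ge 1}$ be i.i.d. random vectors in $\mathbb{R}^2$ with generic element $(A,B)$, where $A>0$ a.s., let $X_0$ be a real random variable independent of $(A_n,B_n)_{n\ge1}$, and let $X_n=A_nX_{n-1}+B_n$ for $n\ge1$. Write $g(t)\sim h(t)$ for $\lim_{t\to\infty} g(t)/h(t)=1$, and let $A'$ be an independent copy of $A$. Assume that for some $\alpha>0$: 1. $\mathbb{P}[A>ty]\sim y^{-\alpha}\,\mathbb{P}[A>t]$ for every $y>0$; 2. $\mathbb{P}[AA'>t]\sim 2\,\mathbb{E}[A^\alpha]\,\mathbb{P}[A>t]$ and $\mathbb{E}[A^\alpha]<1$; 3. $\limsup_{t\to\infty}\mathbb{P}[|B|>t]/\mathbb{P}[A>t]<\infty$. Let $X=\sum_{k=0}^{\infty}B_{k+1}\prod_{j=1}^{k}A_j$ (under 1--3 this series converges a.s.), and assume moreover that there are measurable functions $f_+,f_-:\mathbb{R}\to[0,\infty)$ such that, for every $y$ in the support of the law of $X$, $$\lim_{t\to\infty}\frac{\mathbb{P}[Ay+B>t]}{\mathbb{P}[A>t]}=f_+(y),\qquad \lim_{t\to\infty}\frac{\mathbb{P}[Ay+B<-t]}{\mathbb{P}[A>t]}=f_-(y).$$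 Then the series defining $X$ converges absolutely a.s., its law satisfies $X\stackrel{d}{=}AX+B$ with $X$ independent of $(A,B)$, the chain $X_n$ converges weakly to $X$, the expectations $\mathbb{E}[f_\pm(X)]$ are finite, and $$\lim_{t\to\infty}\frac{\mathbb{P}[X>t]}{\mathbb{P}[A>t]}=\frac{\mathbb{E}[f_+(X)]}{1-\mathbb{E}[A^\alpha]},\qquad \lim_{t\to\infty}\frac{\mathbb{P}[X<-t]}{\mathbb{P}[A>t]}=\frac{\mathbb{E}[f_-(X)]}{1-\mathbb{E}[A^\alpha]}.$$ -/

import Mathlib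

open MeasureTheory ProbabilityTheory Filter Topology

namespace RandomDifference

/-- `g ∼ h` at `+∞`, that is `g(t) / h(t) → 1` as `t → ∞`. -/
def TailEquiv (g h : ℝ → ℝ) : Prop :=
  Tendsto (fun t => g t / h t) atTop (𝓝 1)

/-- The right tail `t ↦ ℙ[Y > t]` of a real random variable `Y`. -/
noncomputable def tail {Ω : Type*} [MeasurableSpace Ω] (P : Measure Ω) (Y : Ω → ℝ) (t : ℝ) : ℝ :=
  P.real {ω | t < Y ω}

/-- The left tail `t ↦ ℙ[Y < -t]` of a real random variable `Y`. -/
noncomputable def leftTail {Ω : Type*} [MeasurableSpace Ω] (P : Measure Ω) (Y : Ω → ℝ)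
    (t : ℝ) : ℝ :=
  P.real {ω | Y ω < -t}

/-- The chain driven by the random vectors `(A 0, B 0), (A 1, B 1), …` and started at `X₀`:
the pair `(A n, B n)` is the one applied in the step from time `n` to time `n + 1`. -/
def chain {Ω : Type*} (A B : ℕ → Ω → ℝ) (X₀ : Ω → ℝ) : ℕ → Ω → ℝ
  | 0 => X₀
  | n + 1 => fun ω => A n ω * chain A B X₀ n ω + B n ω

/-- The `k`-th term `(∏_{j < k} A j) * B k` of the perpetuity series. -/
def perpetuityTerm {Ω : Type*} (A B : ℕ → Ω → ℝ) (k : ℕ) (ω : Ω) : ℝ :=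
  B k ω * ∏ j ∈ Finset.range k, A j ω

/-- The perpetuity `∑_k (∏_{j < k} A j) * B k`. -/
noncomputable def perpetuity {Ω : Type*} (A B : ℕ → Ω → ℝ) (ω : Ω) : ℝ :=
  ∑' k, perpetuityTerm A B k ω

end RandomDifference

/-!
Write `F̄` for the tail of `A` and `ρ = 𝔼[A ^ α] < 1`. The law of `X` is a fixed point of
`X ↦ A X + B`, and this map acts on tail constants as a contraction of ratio `ρ`. Indeed, split
`ℙ[A X + B > t]` according to `|X| ≤ K` or `|X| > K`. On `|X| ≤ K`, regular variation of `F̄` and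
dominated convergence give the contribution `𝔼[f₊(X); |X| ≤ K]`. On `|X| > K` the term `B` is
negligible and, conditioning on `A`, a bound `ℙ[X > s] ≤ L F̄(s)` for large `s` allows one to
compare `X` with `L` times an independent copy `A'` of `A`. By the convolution condition together
with Breiman's lemma for `A'` cut off at `K`,
`ℙ[A' > K, A A' > t] ∼ (2 ρ - 𝔼[A ^ α; A ≤ K]) F̄(t)`,
where the constant tends to `ρ` as `K → ∞`. Hence an eventual upper bound `L` for
`ℙ[X > t] / F̄(t)` improves to anything above `𝔼[f₊(X)] + ρ L`; lower bounds improve in the same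
way. Iterating `L ↦ 𝔼[f₊(X)] + ρ L` leaves `𝔼[f₊(X)] / (1 - ρ)` as the only possible limit.

The same contraction bounds the tails of all partial sums of `∑ₖ |Bₖ| ∏_{j < k} Aⱼ` by one multiple
of `F̄`, whence absolute convergence. Weak convergence of the chain follows by reversing time: its
`n`-th state has the law of the `n`-th partial sum of the series plus `X₀ ∏_{j < n} Aⱼ`, which
converges almost surely.
-/

namespace RandomDifference

section Contraction

variable {ι : Type*} {l : Filter ι} {u : ι → ℝ} {e ρ : ℝ}

theorem eventually_lt_of_affine_improvement (hρ0 : 0 ≤ ρ) (hρ1 : ρ < 1) {C b : ℝ}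
    (hC : ∀ᶠ t in l, u t ≤ C)
    (himprove : ∀ L L', (∀ᶠ t in l, u t ≤ L) → e + ρ * L < L' → ∀ᶠ t in l, u t ≤ L')
    (hb : e / (1 - ρ) < b) : ∀ᶠ t in l, u t < b := by
  obtain ⟨x, hx, hxb⟩ := exists_between hb
  have hfix : e + ρ * x < x := by
    have := (div_lt_iff₀ (sub_pos.2 hρ1)).1 hx
    linarith
  have hiterate : ∀ n : ℕ, ∀ᶠ t in l, u t ≤ x + ρ ^ n * (C - x) := by
    intro n
    induction n with
    | zero => simpa using hC
    | succ n ih => exact himprove _ _ ih (by rw [pow_succ']; linarith)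
  have hlim : Tendsto (fun n : ℕ => x + ρ ^ n * (C - x)) atTop (𝓝 x) := by
    simpa using ((tendsto_pow_atTop_nhds_zero_of_lt_one hρ0 hρ1).mul_const (C - x)).const_add x
  obtain ⟨n, hn⟩ := (hlim.eventually_lt_const hxb).exists
  exact (hiterate n).mono fun t ht => ht.trans_lt hn

theorem tendsto_of_affine_improvement (hρ0 : 0 ≤ ρ) (hρ1 : ρ < 1) {c C : ℝ}
    (hc : ∀ᶠ t in l, c ≤ u t) (hC : ∀ᶠ t in l, u t ≤ C)
    (hupper : ∀ L L', (∀ᶠ t in l, u t ≤ L) → e + ρ * L < L' → ∀ᶠ t in l, u t ≤ L')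
    (hlower : ∀ L L', (∀ᶠ t in l, L ≤ u t) → L' < e + ρ * L → ∀ᶠ t in l, L' ≤ u t) :
    Tendsto u l (𝓝 (e / (1 - ρ))) := by
  refine tendsto_order.2 ⟨fun b hb => ?_, fun b hb =>
    eventually_lt_of_affine_improvement hρ0 hρ1 hC hupper hb⟩
  have hneg : ∀ᶠ t in l, -u t < -b := by
    refine eventually_lt_of_affine_improvement (e := -e) hρ0 hρ1 (C := -c)
      (hc.mono fun t => neg_le_neg) (fun L L' hL hL' => ?_)
      (by rw [neg_div]; exact neg_lt_neg hb)
    refine (hlower (-L) (-L') (hL.mono fun t ht => neg_le.1 ht) (by linarith)).mono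
      fun t => neg_le.2
  exact hneg.mono fun t => neg_lt_neg_iff.1

end Contraction

variable {Ω : Type*} [MeasurableSpace Ω] {P : Measure Ω}

section Tail

theorem tail_nonneg (Y : Ω → ℝ) (t : ℝ) : 0 ≤ tail P Y t := measureReal_nonneg

theorem tail_antitone [IsFiniteMeasure P] (Y : Ω → ℝ) : Antitone (tail P Y) :=
  fun _ _ hst => measureReal_mono fun _ hω => lt_of_le_of_lt hst hω

theorem tail_mono_of_ae_le [IsFiniteMeasure P] {Y Z : Ω → ℝ} (h : Y ≤ᵐ[P] Z) (t : ℝ) :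
    tail P Y t ≤ tail P Z t :=
  ENNReal.toReal_mono (measure_ne_top _ _)
    (measure_mono_ae (h.mono fun _ hω hlt => lt_of_lt_of_le hlt hω))

theorem tail_eq_of_identDistrib {Y Z : Ω → ℝ} (h : IdentDistrib Y Z P P) (t : ℝ) :
    tail P Y t = tail P Z t :=
  congrArg ENNReal.toReal (h.measure_mem_eq measurableSet_Ioi)

theorem leftTail_eq_tail_neg (Y : Ω → ℝ) : leftTail P Y = tail P fun ω => -Y ω := by
  funext t
  simp only [leftTail, tail, lt_neg]

theorem leftTail_eq_of_identDistrib {Y Z : Ω → ℝ} (h : IdentDistrib Y Z P P) (t : ℝ) :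
    leftTail P Y t = leftTail P Z t :=
  congrArg ENNReal.toReal (h.measure_mem_eq measurableSet_Iio)

theorem tail_le_tail_abs [IsFiniteMeasure P] (Y : Ω → ℝ) (t : ℝ) :
    tail P Y t ≤ tail P (fun ω => |Y ω|) t :=
  tail_mono_of_ae_le (ae_of_all _ fun _ => le_abs_self _) t

theorem leftTail_le_tail_abs [IsFiniteMeasure P] (Y : Ω → ℝ) (t : ℝ) :
    leftTail P Y t ≤ tail P (fun ω => |Y ω|) t := by
  rw [leftTail_eq_tail_neg]
  exact tail_mono_of_ae_le (ae_of_all _ fun _ => neg_le_abs _) t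

theorem aecover_le {Y : Ω → ℝ} (hY : Measurable Y) :
    AECover P atTop fun K : ℝ => {ω | Y ω ≤ K} where
  ae_eventually_mem := ae_of_all _ fun ω => eventually_ge_atTop (Y ω)
  measurableSet _ := measurableSet_le hY measurable_const

theorem tendsto_tail_atTop [IsFiniteMeasure P] {Y : Ω → ℝ} (hY : Measurable Y) :
    Tendsto (tail P Y) atTop (𝓝 0) := by
  have hinter : (⋂ t : ℝ, {ω | t < Y ω}) = ∅ :=
    Set.eq_empty_of_forall_notMem fun ω hω => lt_irrefl (Y ω) (Set.mem_iInter.1 hω (Y ω))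
  have hlim := tendsto_measure_iInter_atTop (μ := P)
    (fun t : ℝ => (measurableSet_lt measurable_const hY).nullMeasurableSet)
    (fun _ _ hst _ hω => lt_of_le_of_lt hst hω) ⟨0, measure_ne_top _ _⟩
  rw [hinter, measure_empty] at hlim
  exact (ENNReal.tendsto_toReal ENNReal.zero_ne_top).comp hlim

end Tail

section Conditioning

variable {E G : Type*} [MeasurableSpace E] [MeasurableSpace G] {U : Ω → E} {V : Ω → G}

theorem measurable_measureReal_section [IsFiniteMeasure P] (hV : Measurable V) {R : Set (E × G)}
    (hR : MeasurableSet R) : Measurable fun x => P.real {ω | (x, V ω) ∈ R} := by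
  have hsection : ∀ x, P.real {ω | (x, V ω) ∈ R} = (P.map V (Prod.mk x ⁻¹' R)).toReal := by
    intro x
    rw [Measure.map_apply hV (measurable_prodMk_left hR)]
    rfl
  simp only [hsection]
  exact (measurable_measure_prodMk_left hR).ennreal_toReal

theorem measureReal_prodMk_mem_eq_integral [IsFiniteMeasure P] (hU : Measurable U)
    (hV : Measurable V) (hUV : IndepFun U V P) {R : Set (E × G)} (hR : MeasurableSet R) :
    P.real {ω | (U ω, V ω) ∈ R} = ∫ ω, P.real {ω' | (U ω, V ω') ∈ R} ∂P := by
  have hjoint : P {ω | (U ω, V ω) ∈ R} = ∫⁻ ω, P {ω' | (U ω, V ω') ∈ R} ∂P := by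
    calc P {ω | (U ω, V ω) ∈ R} = P.map (fun ω => (U ω, V ω)) R :=
          (Measure.map_apply (hU.prodMk hV) hR).symm
      _ = ∫⁻ x, P.map V (Prod.mk x ⁻¹' R) ∂(P.map U) := by
          rw [(indepFun_iff_map_prod_eq_prod_map_map hU.aemeasurable hV.aemeasurable).1 hUV,
            Measure.prod_apply hR]
      _ = ∫⁻ ω, P {ω' | (U ω, V ω') ∈ R} ∂P := by
          rw [lintegral_map (measurable_measure_prodMk_left hR) hU]
          simp only [Measure.map_apply hV (measurable_prodMk_left hR)]
          rfl
  have hmeas := ((measurable_measureReal_section (P := P) hV hR).comp hU).ennreal_ofReal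
  simp only [Function.comp_def, measureReal_def, ENNReal.ofReal_toReal (measure_ne_top P _)]
    at hmeas
  rw [measureReal_def, hjoint]
  exact (integral_toReal hmeas.aemeasurable (ae_of_all _ fun ω => measure_lt_top _ _)).symm

theorem integrable_measureReal_section [IsFiniteMeasure P] (hU : Measurable U)
    (hV : Measurable V) {R : Set (E × G)} (hR : MeasurableSet R) :
    Integrable (fun ω => P.real {ω' | (U ω, V ω') ∈ R}) P :=
  Integrable.of_bound ((measurable_measureReal_section hV hR).comp hU).aestronglyMeasurable
    (P.real Set.univ) (ae_of_all _ fun ω => by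
      rw [Real.norm_of_nonneg measureReal_nonneg]
      exact measureReal_mono (Set.subset_univ _))

theorem measureReal_and_prodMk_mem_eq_setIntegral [IsFiniteMeasure P] (hU : Measurable U)
    (hV : Measurable V) (hUV : IndepFun U V P) {S : Set E} (hS : MeasurableSet S)
    {R : Set (E × G)} (hR : MeasurableSet R) :
    P.real {ω | U ω ∈ S ∧ (U ω, V ω) ∈ R} =
      ∫ ω in U ⁻¹' S, P.real {ω' | (U ω, V ω') ∈ R} ∂P := by
  have hjoint := measureReal_prodMk_mem_eq_integral hU hV hUV ((measurable_fst hS).inter hR)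
  rw [← integral_indicator (hU hS)]
  refine hjoint.trans (integral_congr_ae (ae_of_all _ fun ω => ?_))
  by_cases hω : U ω ∈ S <;> simp [hω]

theorem tendsto_measureReal_and_prodMk_mem_div [IsFiniteMeasure P] (hU : Measurable U)
    (hV : Measurable V) (hUV : IndepFun U V P) {S : Set E} (hS : MeasurableSet S)
    {R : ℝ → Set (E × G)} (hR : ∀ t, MeasurableSet (R t)) {F : ℝ → ℝ} (hF : ∀ t, 0 ≤ F t)
    {D : ℝ} (hD : ∀ᶠ t in atTop, ∀ x ∈ S, P.real {ω | (x, V ω) ∈ R t} / F t ≤ D)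
    {g : Ω → ℝ} (hg : ∀ᵐ ω ∂P, U ω ∈ S →
      Tendsto (fun t => P.real {ω' | (U ω, V ω') ∈ R t} / F t) atTop (𝓝 (g ω))) :
    IntegrableOn g (U ⁻¹' S) P ∧
      Tendsto (fun t => P.real {ω | U ω ∈ S ∧ (U ω, V ω) ∈ R t} / F t) atTop
        (𝓝 (∫ ω in U ⁻¹' S, g ω ∂P)) := by
  have hmeas : ∀ t, AEStronglyMeasurable (fun ω => P.real {ω' | (U ω, V ω') ∈ R t} / F t)
      (P.restrict (U ⁻¹' S)) := fun t =>
    (((measurable_measureReal_section hV (hR t)).comp hU).div_const _).aestronglyMeasurable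
  have hlim : ∀ᵐ ω ∂P.restrict (U ⁻¹' S),
      Tendsto (fun t => P.real {ω' | (U ω, V ω') ∈ R t} / F t) atTop (𝓝 (g ω)) :=
    (ae_restrict_iff' (hU hS)).2 hg
  have hbound : ∀ᶠ t in atTop, ∀ x ∈ S, ‖P.real {ω | (x, V ω) ∈ R t} / F t‖ ≤ D :=
    hD.mono fun t ht x hx => by
      rw [Real.norm_of_nonneg (div_nonneg measureReal_nonneg (hF t))]
      exact ht x hx
  refine ⟨Integrable.of_bound (aestronglyMeasurable_of_tendsto_ae atTop hmeas hlim) D ?_, ?_⟩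
  · filter_upwards [hlim, ae_restrict_mem (hU hS)] with ω hω hωS
    exact le_of_tendsto hω.norm (hbound.mono fun t ht => ht _ hωS)
  · simp only [measureReal_and_prodMk_mem_eq_setIntegral hU hV hUV hS (hR _), ← integral_div]
    exact tendsto_integral_filter_of_dominated_convergence (fun _ => D)
      (Eventually.of_forall hmeas)
      (hbound.mono fun t ht => (ae_restrict_mem (hU hS)).mono fun ω => ht _)
      (integrable_const _) hlim

-- Conditionally on `A = a > 0`, both events are determined by a tail at `max k (s / a) ≥ k`.
theorem mul_measureReal_lt_and_lt_mul_le_of_tail_le [IsFiniteMeasure P] {A Y Z : Ω → ℝ}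
    (hA : Measurable A) (hpos : ∀ᵐ ω ∂P, 0 < A ω) (hY : Measurable Y) (hAY : IndepFun A Y P)
    (hZ : Measurable Z) (hAZ : IndepFun A Z P) {c C k : ℝ}
    (h : ∀ t, k ≤ t → c * tail P Y t ≤ C * tail P Z t) (s : ℝ) :
    c * P.real {ω | k < Y ω ∧ s < A ω * Y ω} ≤ C * P.real {ω | k < Z ω ∧ s < A ω * Z ω} := by
  have hR : MeasurableSet {p : ℝ × ℝ | k < p.2 ∧ s < p.1 * p.2} :=
    (measurableSet_lt measurable_const measurable_snd).inter
      (measurableSet_lt measurable_const (measurable_fst.mul measurable_snd))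
  have hsection : ∀ (W : Ω → ℝ) {a : ℝ}, 0 < a →
      P.real {ω | (a, W ω) ∈ {p : ℝ × ℝ | k < p.2 ∧ s < p.1 * p.2}} =
        tail P W (max k (s / a)) := by
    intro W a ha
    simp only [tail, max_lt_iff, div_lt_iff₀' ha, Set.mem_ofPred_eq]
  have hYint := measureReal_prodMk_mem_eq_integral hA hY hAY hR
  have hZint := measureReal_prodMk_mem_eq_integral hA hZ hAZ hR
  simp only [Set.mem_ofPred_eq] at hYint hZint
  rw [hYint, hZint, ← integral_const_mul, ← integral_const_mul]
  refine integral_mono_ae ((integrable_measureReal_section hA hY hR).const_mul c)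
    ((integrable_measureReal_section hA hZ hR).const_mul C) ?_
  filter_upwards [hpos] with ω hω
  have hle := h _ (le_max_left k (s / A ω))
  rwa [← hsection Y hω, ← hsection Z hω] at hle

end Conditioning

section RegularVariation

/-- The right tail of `A` is regularly varying at `+∞` with index `-α`. -/
def RegularlyVaryingTail (P : Measure Ω) (A : Ω → ℝ) (α : ℝ) : Prop :=
  ∀ y : ℝ, 0 < y →
    TailEquiv (fun t => tail P A (t * y)) (fun t => y ^ (-α) * tail P A t)

theorem exists_forall_tail_le_of_eventually_tail_le [IsFiniteMeasure P] {A Y : Ω → ℝ}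
    (hpos : ∀ t, 0 < tail P A t) {c : ℝ} (h : ∀ᶠ t in atTop, tail P Y t ≤ c * tail P A t) :
    ∃ C, ∀ t, tail P Y t ≤ C * tail P A t := by
  obtain ⟨T, hT⟩ := eventually_atTop.1 h
  refine ⟨max c (P.real Set.univ / tail P A T), fun t => ?_⟩
  rcases le_total T t with hTt | htT
  · exact (hT t hTt).trans (mul_le_mul_of_nonneg_right (le_max_left _ _) (hpos t).le)
  · calc tail P Y t ≤ P.real Set.univ := measureReal_mono (Set.subset_univ _)
      _ = P.real Set.univ / tail P A T * tail P A T := (div_mul_cancel₀ _ (hpos T).ne').symm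
      _ ≤ _ := mul_le_mul (le_max_right _ _) (tail_antitone A htT) (hpos T).le
          ((div_nonneg measureReal_nonneg (hpos T).le).trans (le_max_right _ _))

theorem exists_forall_tail_le_of_limsup_lt_top [IsFiniteMeasure P] {A Y : Ω → ℝ}
    (hpos : ∀ t, 0 < tail P A t)
    (h : limsup (fun t : ℝ => P {ω | t < Y ω} / P {ω | t < A ω}) atTop < ⊤) :
    ∃ C, ∀ t, tail P Y t ≤ C * tail P A t := by
  obtain ⟨c, hc, hcTop⟩ := exists_between h
  refine exists_forall_tail_le_of_eventually_tail_le hpos (c := c.toReal) ?_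
  filter_upwards [eventually_lt_of_limsup_lt hc] with t ht
  have hle : P {ω | t < Y ω} ≤ c * P {ω | t < A ω} :=
    (ENNReal.div_le_iff (fun h0 => (hpos t).ne' (by simp [tail, measureReal_def, h0]))
      (measure_ne_top _ _)).1 ht.le
  have := ENNReal.toReal_mono (ENNReal.mul_ne_top hcTop.ne (measure_ne_top _ _)) hle
  rwa [ENNReal.toReal_mul] at this

namespace RegularlyVaryingTail

variable {A : Ω → ℝ} {α : ℝ}

theorem tail_pos [IsFiniteMeasure P] (h : RegularlyVaryingTail P A α) (t : ℝ) :
    0 < tail P A t := by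
  obtain ⟨s, hs, hts⟩ :=
    (((h 1 one_pos).eventually_ne one_ne_zero).and (eventually_ge_atTop t)).exists
  exact ((tail_nonneg A s).lt_of_ne fun h0 => hs (by simp [← h0])).trans_le
    (tail_antitone A hts)

theorem tendsto_tail_mul_div [IsFiniteMeasure P] (h : RegularlyVaryingTail P A α) {y : ℝ}
    (hy : 0 < y) : Tendsto (fun t => tail P A (t * y) / tail P A t) atTop (𝓝 (y ^ (-α))) := by
  have hlim := (h y hy).const_mul (y ^ (-α))
  rw [mul_one] at hlim
  refine hlim.congr fun t => ?_
  have := (h.tail_pos t).ne'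
  have := (Real.rpow_pos_of_pos hy (-α)).ne'
  field_simp

theorem eventually_eventually_tail_mul_div_mem [IsFiniteMeasure P]
    (h : RegularlyVaryingTail P A α) {U : Set ℝ} (hU : U ∈ 𝓝 1) :
    ∀ᶠ y in 𝓝 (1 : ℝ), ∀ᶠ t in atTop, tail P A (t * y) / tail P A t ∈ U := by
  have hcont : Tendsto (fun y : ℝ => y ^ (-α)) (𝓝 1) (𝓝 1) := by
    simpa using (Real.continuousAt_rpow_const 1 (-α) (Or.inl one_ne_zero)).tendsto
  filter_upwards [hcont.eventually (eventually_mem_nhds_iff.2 hU), lt_mem_nhds one_pos]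
    with y hyU hy
  exact (h.tendsto_tail_mul_div hy).eventually hyU

theorem exists_lt_one_eventually_mul_tail_mul_le [IsFiniteMeasure P]
    (h : RegularlyVaryingTail P A α) {r θ : ℝ} (hrθ : r < θ) :
    ∃ y ∈ Set.Ioo (0 : ℝ) 1, ∀ᶠ t in atTop, r * tail P A (t * y) ≤ θ * tail P A t := by
  have hU : ∀ᶠ x in 𝓝 (1 : ℝ), r * x < θ :=
    (continuous_const.mul continuous_id).continuousAt.eventually_lt_const (by simpa using hrθ)
  obtain ⟨y, hy, hyt⟩ := (((h.eventually_eventually_tail_mul_div_mem hU).filter_mono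
    nhdsWithin_le_nhds).and (Ioo_mem_nhdsLT one_pos)).exists
  refine ⟨y, hyt, hy.mono fun t ht => ?_⟩
  have := mul_le_mul_of_nonneg_right (le_of_lt ht) (h.tail_pos t).le
  rwa [mul_assoc, div_mul_cancel₀ _ (h.tail_pos t).ne'] at this

theorem exists_one_lt_eventually_mul_tail_le [IsFiniteMeasure P]
    (h : RegularlyVaryingTail P A α) {r θ : ℝ} (hrθ : r < θ) :
    ∃ y > (1 : ℝ), ∀ᶠ t in atTop, r * tail P A t ≤ θ * tail P A (t * y) := by
  have hU : ∀ᶠ x in 𝓝 (1 : ℝ), r < θ * x :=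
    (continuous_const.mul continuous_id).continuousAt.eventually_const_lt (by simpa using hrθ)
  obtain ⟨y, hy, hyt⟩ := (((h.eventually_eventually_tail_mul_div_mem hU).filter_mono
    nhdsWithin_le_nhds).and (self_mem_nhdsWithin (s := Set.Ioi 1))).exists
  refine ⟨y, hyt, hy.mono fun t ht => ?_⟩
  have := mul_le_mul_of_nonneg_right (le_of_lt ht) (h.tail_pos t).le
  rwa [mul_assoc, div_mul_cancel₀ _ (h.tail_pos t).ne'] at this

-- The bounded case of Breiman's lemma.
theorem tendsto_measureReal_mem_Ioc_and_lt_mul_div [IsFiniteMeasure P]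
    (h : RegularlyVaryingTail P A α) (hA : Measurable A) {V : Ω → ℝ} (hV : Measurable V)
    (hVA : IndepFun V A P) {K : ℝ} (hK : 0 < K) :
    Tendsto (fun s => P.real {ω | V ω ∈ Set.Ioc 0 K ∧ s < A ω * V ω} / tail P A s) atTop
      (𝓝 (∫ ω in V ⁻¹' Set.Ioc 0 K, V ω ^ α ∂P)) := by
  have hsection : ∀ {v s : ℝ}, 0 < v →
      P.real {ω | s < A ω * v} = tail P A (s * v⁻¹) := by
    intro v s hv
    simp only [tail, ← div_eq_mul_inv, div_lt_iff₀ hv]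
  have hR : ∀ s, MeasurableSet {p : ℝ × ℝ | s < p.2 * p.1} := fun s =>
    measurableSet_lt measurable_const (measurable_snd.mul measurable_fst)
  refine (tendsto_measureReal_and_prodMk_mem_div hV hA hVA measurableSet_Ioc hR
    (tail_nonneg A) (D := K⁻¹ ^ (-α) + 1) ?_ (ae_of_all _ fun ω hω => ?_)).2
  · filter_upwards [(h.tendsto_tail_mul_div (inv_pos.2 hK)).eventually_le_const (lt_add_one _),
      eventually_ge_atTop 0] with s hs hs0 v hv
    rw [hsection hv.1]
    exact (div_le_div_of_nonneg_right (tail_antitone A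
      (mul_le_mul_of_nonneg_left (inv_anti₀ hv.1 hv.2) hs0)) (tail_nonneg _ _)).trans hs
  · simp only [Set.mem_ofPred_eq, hsection hω.1]
    have hlim := h.tendsto_tail_mul_div (inv_pos.2 hω.1)
    rwa [Real.rpow_neg (inv_pos.2 hω.1).le, Real.inv_rpow hω.1.le, inv_inv] at hlim

end RegularlyVaryingTail

end RegularVariation

section ConvolutionEquivalence

/-- `A` is a positive random variable with regularly varying right tail and finite moment of
order `α`, `A'` is an independent copy of it, and the tail of the product `A * A'` is
asymptotically `2 * 𝔼[A ^ α]` times that of `A`: the law of `log A` is convolution equivalent. -/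
structure IsConvolutionEquivalent (P : Measure Ω) (A A' : Ω → ℝ) (α : ℝ) : Prop where
  measurable : Measurable A
  measurable_copy : Measurable A'
  indepFun : IndepFun A A' P
  identDistrib : IdentDistrib A' A P P
  pos : ∀ᵐ ω ∂P, 0 < A ω
  regular : RegularlyVaryingTail P A α
  integrable : Integrable (fun ω => A ω ^ α) P
  product : TailEquiv (tail P fun ω => A ω * A' ω)
    (fun t => 2 * (∫ ω, A ω ^ α ∂P) * tail P A t)

namespace IsConvolutionEquivalent

variable {A A' : Ω → ℝ} {α : ℝ}

theorem copy_pos (h : IsConvolutionEquivalent P A A' α) : ∀ᵐ ω ∂P, 0 < A' ω :=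
  h.identDistrib.symm.ae_snd measurableSet_Ioi h.pos

theorem identDistrib_rpow (h : IsConvolutionEquivalent P A A' α) :
    IdentDistrib (fun ω => A' ω ^ α) (fun ω => A ω ^ α) P P :=
  h.identDistrib.comp (measurable_id.pow_const α)

variable [IsProbabilityMeasure P]

theorem moment_pos (h : IsConvolutionEquivalent P A A' α) : 0 < ∫ ω, A ω ^ α ∂P := by
  have hrpow : ∀ᵐ ω ∂P, 0 < A ω ^ α := h.pos.mono fun ω hω => Real.rpow_pos_of_pos hω α
  refine (integral_nonneg_of_ae (hrpow.mono fun _ => le_of_lt)).lt_of_ne fun h0 => ?_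
  have hzero := (integral_eq_zero_iff_of_nonneg_ae (hrpow.mono fun _ => le_of_lt)
    h.integrable).1 h0.symm
  obtain ⟨ω, hω0, hωpos⟩ := (hzero.and hrpow).exists
  exact hωpos.ne' hω0

theorem tendsto_tail_product_div (h : IsConvolutionEquivalent P A A' α) :
    Tendsto (fun t => tail P (fun ω => A ω * A' ω) t / tail P A t) atTop
      (𝓝 (2 * ∫ ω, A ω ^ α ∂P)) := by
  have hlim := h.product.const_mul (2 * ∫ ω, A ω ^ α ∂P)
  rw [mul_one] at hlim
  refine hlim.congr fun t => ?_
  have := (h.regular.tail_pos t).ne'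
  have := h.moment_pos.ne'
  field_simp

theorem tendsto_measureReal_lt_copy_and_lt_mul_div (h : IsConvolutionEquivalent P A A' α)
    {K : ℝ} (hK : 0 < K) :
    Tendsto (fun s => P.real {ω | K < A' ω ∧ s < A ω * A' ω} / tail P A s) atTop
      (𝓝 (2 * (∫ ω, A ω ^ α ∂P) - ∫ ω in A' ⁻¹' Set.Ioc 0 K, A' ω ^ α ∂P)) := by
  refine (h.tendsto_tail_product_div.sub (h.regular.tendsto_measureReal_mem_Ioc_and_lt_mul_div
    h.measurable h.measurable_copy h.indepFun.symm hK)).congr fun s => ?_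
  rw [← sub_div]
  congr 1
  have hsplit := measureReal_inter_add_sdiff (μ := P) (s := {ω | s < A ω * A' ω})
    (h.measurable_copy (measurableSet_Ioc (a := 0) (b := K)))
  have hsmall : {ω | A' ω ∈ Set.Ioc 0 K ∧ s < A ω * A' ω} =
      {ω | s < A ω * A' ω} ∩ A' ⁻¹' Set.Ioc 0 K := Set.inter_comm _ _
  have hlarge : P.real {ω | K < A' ω ∧ s < A ω * A' ω} =
      P.real ({ω | s < A ω * A' ω} \ A' ⁻¹' Set.Ioc 0 K) := by
    refine measureReal_congr ?_
    filter_upwards [h.copy_pos] with ω hω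
    refine propext ⟨fun hω' => ⟨hω'.2, fun hmem => hω'.1.not_ge hmem.2⟩, fun hω' => ⟨?_, hω'.1⟩⟩
    exact not_le.1 fun hle => hω'.2 ⟨hω, hle⟩
  rw [hsmall, hlarge, tail, ← hsplit, add_sub_cancel_left]

-- For large `K` the factor `A'` has used up one of the two contributions `𝔼[A ^ α]` of `A * A'`.
theorem eventually_eventually_measureReal_div_mem (h : IsConvolutionEquivalent P A A' α)
    {U : Set ℝ} (hU : U ∈ 𝓝 (∫ ω, A ω ^ α ∂P)) :
    ∀ᶠ K in atTop, ∀ᶠ s in atTop,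
      P.real {ω | K < A' ω ∧ s < A ω * A' ω} / tail P A s ∈ U := by
  have hcover : AECover P atTop fun K : ℝ => A' ⁻¹' Set.Ioc 0 K :=
    ⟨h.copy_pos.mono fun ω hω => (eventually_ge_atTop (A' ω)).mono fun K hK => ⟨hω, hK⟩,
      fun K => h.measurable_copy measurableSet_Ioc⟩
  have hmoment := hcover.integral_tendsto_of_countably_generated
    (h.identDistrib_rpow.integrable_iff.2 h.integrable)
  rw [h.identDistrib_rpow.integral_eq] at hmoment
  have hlim := hmoment.const_sub (2 * ∫ ω, A ω ^ α ∂P)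
  rw [two_mul, add_sub_cancel_right, ← two_mul] at hlim
  filter_upwards [hlim.eventually (eventually_mem_nhds_iff.2 hU), eventually_gt_atTop 0]
    with K hKU hK
  exact (h.tendsto_measureReal_lt_copy_and_lt_mul_div hK).eventually hKU

section Comparison

variable {Y : Ω → ℝ} {L L' : ℝ}

theorem eventually_eventually_measureReal_lt_and_lt_mul_le
    (h : IsConvolutionEquivalent P A A' α) (hY : Measurable Y) (hAY : IndepFun A Y P)
    (hL : ∀ᶠ t in atTop, tail P Y t ≤ L * tail P A t) (hL' : (∫ ω, A ω ^ α ∂P) * L < L') :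
    ∀ᶠ K in atTop, ∀ᶠ s in atTop,
      P.real {ω | K < Y ω ∧ s < A ω * Y ω} ≤ L' * tail P A s := by
  have hU : ∀ᶠ x in 𝓝 (∫ ω, A ω ^ α ∂P), x * L < L' :=
    (continuous_id.mul continuous_const).continuousAt.eventually_lt_const hL'
  filter_upwards [h.eventually_eventually_measureReal_div_mem hU, eventually_forall_ge_atTop.2 hL]
    with K hK hLK
  filter_upwards [hK] with s hs
  have hcompare := mul_measureReal_lt_and_lt_mul_le_of_tail_le h.measurable h.pos hY hAY
    h.measurable_copy h.indepFun (c := 1) (C := L) (k := K)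
    (fun t ht => by rw [one_mul, tail_eq_of_identDistrib h.identDistrib]; exact hLK t ht) s
  have hs' := mul_le_mul_of_nonneg_right (le_of_lt hs) (h.regular.tail_pos s).le
  rw [div_mul_eq_mul_div, div_mul_cancel₀ _ (h.regular.tail_pos s).ne'] at hs'
  linarith

theorem eventually_eventually_le_measureReal_lt_and_lt_mul
    (h : IsConvolutionEquivalent P A A' α) (hY : Measurable Y) (hAY : IndepFun A Y P)
    (hL : ∀ᶠ t in atTop, L * tail P A t ≤ tail P Y t) (hL' : L' < (∫ ω, A ω ^ α ∂P) * L) :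
    ∀ᶠ K in atTop, ∀ᶠ s in atTop,
      L' * tail P A s ≤ P.real {ω | K < Y ω ∧ s < A ω * Y ω} := by
  have hU : ∀ᶠ x in 𝓝 (∫ ω, A ω ^ α ∂P), L' < x * L :=
    (continuous_id.mul continuous_const).continuousAt.eventually_const_lt hL'
  filter_upwards [h.eventually_eventually_measureReal_div_mem hU, eventually_forall_ge_atTop.2 hL]
    with K hK hLK
  filter_upwards [hK] with s hs
  have hcompare := mul_measureReal_lt_and_lt_mul_le_of_tail_le h.measurable h.pos
    h.measurable_copy h.indepFun hY hAY (c := L) (C := 1) (k := K)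
    (fun t ht => by rw [one_mul, tail_eq_of_identDistrib h.identDistrib]; exact hLK t ht) s
  have hs' := mul_le_mul_of_nonneg_right (le_of_lt hs) (h.regular.tail_pos s).le
  rw [div_mul_eq_mul_div, div_mul_cancel₀ _ (h.regular.tail_pos s).ne'] at hs'
  linarith

end Comparison

end IsConvolutionEquivalent

end ConvolutionEquivalence

section AffineMap

variable [IsFiniteMeasure P] {A B Y : Ω → ℝ} {α c : ℝ}

theorem eventually_eventually_measureReal_lt_abs_and_lt_abs_le
    (hA : RegularlyVaryingTail P A α)
    (hc : ∀ t, tail P (fun ω => |B ω|) t ≤ c * tail P A t) (hY : Measurable Y)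
    (hYB : IndepFun Y B P) {ε η : ℝ} (hε : 0 < ε) (hη : 0 < η) :
    ∀ᶠ K in atTop, ∀ᶠ t in atTop,
      P.real {ω | K < |Y ω| ∧ t * η < |B ω|} ≤ ε * tail P A t := by
  have hc0 : 0 ≤ c :=
    nonneg_of_mul_nonneg_left ((tail_nonneg _ 0).trans (hc 0)) (hA.tail_pos 0)
  have hproduct : ∀ K s, P.real {ω | K < |Y ω| ∧ s < |B ω|} =
      tail P (fun ω => |Y ω|) K * tail P (fun ω => |B ω|) s := by
    intro K s
    have hindep := (hYB.comp measurable_norm measurable_norm).measure_inter_preimage_eq_mul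
      (Set.Ioi K) (Set.Ioi s) measurableSet_Ioi measurableSet_Ioi
    exact (congrArg ENNReal.toReal hindep).trans ENNReal.toReal_mul
  have hsmall : ∀ᶠ K in atTop, tail P (fun ω => |Y ω|) K * (c * (η ^ (-α) + 1)) < ε :=
    ((tendsto_tail_atTop hY.norm).mul_const _).eventually_lt_const (by rwa [zero_mul])
  filter_upwards [hsmall] with K hK
  filter_upwards [(hA.tendsto_tail_mul_div hη).eventually_le_const (lt_add_one _)] with t ht
  rw [div_le_iff₀ (hA.tail_pos t)] at ht
  calc P.real {ω | K < |Y ω| ∧ t * η < |B ω|}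
      = tail P (fun ω => |Y ω|) K * tail P (fun ω => |B ω|) (t * η) := hproduct K _
    _ ≤ tail P (fun ω => |Y ω|) K * (c * ((η ^ (-α) + 1) * tail P A t)) :=
        mul_le_mul_of_nonneg_left ((hc _).trans (mul_le_mul_of_nonneg_left ht hc0))
          (tail_nonneg _ _)
    _ = tail P (fun ω => |Y ω|) K * (c * (η ^ (-α) + 1)) * tail P A t := by ring
    _ ≤ ε * tail P A t := mul_le_mul_of_nonneg_right hK.le (hA.tail_pos t).le

theorem exists_eventually_tail_mul_add_div_le (hA : RegularlyVaryingTail P A α)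
    (hpos : ∀ᵐ ω ∂P, 0 < A ω) (hc : ∀ t, tail P (fun ω => |B ω|) t ≤ c * tail P A t) {K : ℝ}
    (hK : 0 < K) :
    ∃ D, ∀ᶠ t in atTop, ∀ y, |y| ≤ K → tail P (fun ω => A ω * y + B ω) t / tail P A t ≤ D := by
  have hc0 : 0 ≤ c :=
    nonneg_of_mul_nonneg_left ((tail_nonneg _ 0).trans (hc 0)) (hA.tail_pos 0)
  refine ⟨((2 * K)⁻¹ ^ (-α) + 1) + c * ((1 / 2) ^ (-α) + 1), ?_⟩
  filter_upwards [(hA.tendsto_tail_mul_div (inv_pos.2 (mul_pos two_pos hK))).eventually_le_const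
      (lt_add_one _),
    (hA.tendsto_tail_mul_div one_half_pos).eventually_le_const (lt_add_one _)]
    with t htA htB y hy
  rw [div_le_iff₀ (hA.tail_pos t)] at htA htB ⊢
  have hsplit : tail P (fun ω => A ω * y + B ω) t ≤
      tail P A (t * (2 * K)⁻¹) + tail P (fun ω => |B ω|) (t * (1 / 2)) := by
    refine le_trans (ENNReal.toReal_mono (measure_ne_top _ _) (measure_mono_ae ?_))
      (measureReal_union_le _ _)
    filter_upwards [hpos] with ω hω hlt
    refine or_iff_not_imp_right.2 fun hBle => ?_
    have hlt : t < A ω * y + B ω := hlt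
    have hBle : |B ω| ≤ t * (1 / 2) := not_lt.1 hBle
    have hAy : A ω * y ≤ A ω * K :=
      mul_le_mul_of_nonneg_left ((le_abs_self y).trans hy) hω.le
    change t * (2 * K)⁻¹ < A ω
    rw [← div_eq_mul_inv, div_lt_iff₀ (mul_pos two_pos hK)]
    linarith [le_abs_self (B ω)]
  have := mul_le_mul_of_nonneg_left htB hc0
  linarith [hc (t * (1 / 2))]

theorem integrableOn_and_tendsto_measureReal_abs_le_and_lt_mul_add_div
    (hA : RegularlyVaryingTail P A α) (hAm : Measurable A) (hpos : ∀ᵐ ω ∂P, 0 < A ω)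
    (hB : Measurable B) (hc : ∀ t, tail P (fun ω => |B ω|) t ≤ c * tail P A t)
    (hY : Measurable Y) (hYAB : IndepFun Y (fun ω => (A ω, B ω)) P) {g : Ω → ℝ}
    (hg : ∀ᵐ ω ∂P, Tendsto
      (fun t => tail P (fun ω' => A ω' * Y ω + B ω') t / tail P A t) atTop (𝓝 (g ω)))
    {K : ℝ} (hK : 0 < K) :
    IntegrableOn g {ω | |Y ω| ≤ K} P ∧
      Tendsto (fun t => P.real {ω | |Y ω| ≤ K ∧ t < A ω * Y ω + B ω} / tail P A t) atTop
        (𝓝 (∫ ω in {ω | |Y ω| ≤ K}, g ω ∂P)) := by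
  obtain ⟨D, hD⟩ := exists_eventually_tail_mul_add_div_le hA hpos hc hK
  have hS : MeasurableSet {y : ℝ | |y| ≤ K} := measurableSet_le measurable_norm measurable_const
  have hR : ∀ t, MeasurableSet {p : ℝ × ℝ × ℝ | t < p.2.1 * p.1 + p.2.2} := fun t =>
    measurableSet_lt measurable_const (by fun_prop)
  exact tendsto_measureReal_and_prodMk_mem_div hY (hAm.prodMk hB) hYAB hS hR (tail_nonneg A) hD
    (hg.mono fun ω hω _ => hω)

theorem tail_div_eq_of_fixedPoint (hY : Measurable Y)
    (hfix : IdentDistrib (fun ω => A ω * Y ω + B ω) Y P P) (K t : ℝ) : tail P Y t / tail P A t =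
    P.real {ω | |Y ω| ≤ K ∧ t < A ω * Y ω + B ω} / tail P A t +
      P.real {ω | K < |Y ω| ∧ t < A ω * Y ω + B ω} / tail P A t := by
  have hbounded : {ω | |Y ω| ≤ K ∧ t < A ω * Y ω + B ω} =
      {ω | t < A ω * Y ω + B ω} ∩ {ω | |Y ω| ≤ K} := Set.inter_comm _ _
  have hlarge : {ω | K < |Y ω| ∧ t < A ω * Y ω + B ω} =
      {ω | t < A ω * Y ω + B ω} \ {ω | |Y ω| ≤ K} := by
    ext ω
    simp only [Set.mem_ofPred_eq, Set.mem_sdiff, not_le, and_comm]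
  have hmeas : MeasurableSet {ω | |Y ω| ≤ K} := measurableSet_le hY.norm measurable_const
  rw [← tail_eq_of_identDistrib hfix, ← add_div, hbounded, hlarge,
    measureReal_inter_add_sdiff hmeas, tail]

end AffineMap

section FixedPoint

variable [IsProbabilityMeasure P] {A A' B Y : Ω → ℝ} {α c : ℝ}

namespace IsConvolutionEquivalent

variable (h : IsConvolutionEquivalent P A A' α)
  (hc : ∀ t, tail P (fun ω => |B ω|) t ≤ c * tail P A t) (hY : Measurable Y)
  (hYAB : IndepFun Y (fun ω => (A ω, B ω)) P)
include h hc hY hYAB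

theorem eventually_eventually_measureReal_lt_abs_and_lt_mul_add_le {L L' : ℝ}
    (hL : ∀ᶠ t in atTop, tail P Y t ≤ L * tail P A t) (hL' : (∫ ω, A ω ^ α ∂P) * L < L') :
    ∀ᶠ K in atTop, ∀ᶠ t in atTop,
      P.real {ω | K < |Y ω| ∧ t < A ω * Y ω + B ω} ≤ L' * tail P A t := by
  obtain ⟨L₁, hL₁, hL₁'⟩ := exists_between hL'
  obtain ⟨L₂, hL₂, hL₂'⟩ := exists_between hL₁'
  obtain ⟨y, ⟨hy0, hy1⟩, hy⟩ := h.regular.exists_lt_one_eventually_mul_tail_mul_le hL₂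
  filter_upwards [
    h.eventually_eventually_measureReal_lt_and_lt_mul_le hY
      (hYAB.comp measurable_id measurable_fst).symm hL hL₁,
    eventually_eventually_measureReal_lt_abs_and_lt_abs_le h.regular hc hY
      (hYAB.comp measurable_id measurable_snd) (sub_pos.2 hL₂') (sub_pos.2 hy1)]
    with K hKA hKB
  filter_upwards [(tendsto_id.atTop_mul_const hy0).eventually hKA, hKB, hy,
    eventually_ge_atTop 0] with t htA htB hty ht
  have hsplit : P.real {ω | K < |Y ω| ∧ t < A ω * Y ω + B ω} ≤
      P.real {ω | K < Y ω ∧ t * y < A ω * Y ω} +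
        P.real {ω | K < |Y ω| ∧ t * (1 - y) < |B ω|} := by
    refine le_trans (ENNReal.toReal_mono (measure_ne_top _ _) (measure_mono_ae ?_))
      (measureReal_union_le _ _)
    filter_upwards [h.pos] with ω hω hlt
    obtain ⟨hKY, hlt⟩ : K < |Y ω| ∧ t < A ω * Y ω + B ω := hlt
    rcases lt_or_ge (t * (1 - y)) |B ω| with hBt | hBt
    · exact Or.inr ⟨hKY, hBt⟩
    · have hAY : t * y < A ω * Y ω := by linarith [le_abs_self (B ω)]
      have hYpos : 0 < Y ω := pos_of_mul_pos_right ((mul_nonneg ht hy0.le).trans_lt hAY) hω.le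
      exact Or.inl ⟨by rwa [abs_of_pos hYpos] at hKY, hAY⟩
  simp only [id] at htA
  linarith

theorem eventually_eventually_le_measureReal_lt_abs_and_lt_mul_add {L L' : ℝ}
    (hL : ∀ᶠ t in atTop, L * tail P A t ≤ tail P Y t) (hL' : L' < (∫ ω, A ω ^ α ∂P) * L) :
    ∀ᶠ K in atTop, ∀ᶠ t in atTop,
      L' * tail P A t ≤ P.real {ω | K < |Y ω| ∧ t < A ω * Y ω + B ω} := by
  obtain ⟨L₂, hL₂', hL₂⟩ := exists_between hL'
  obtain ⟨L₁, hL₁', hL₁⟩ := exists_between hL₂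
  obtain ⟨y, hy1, hy⟩ := h.regular.exists_one_lt_eventually_mul_tail_le hL₁'
  filter_upwards [
    h.eventually_eventually_le_measureReal_lt_and_lt_mul hY
      (hYAB.comp measurable_id measurable_fst).symm hL hL₁,
    eventually_eventually_measureReal_lt_abs_and_lt_abs_le h.regular hc hY
      (hYAB.comp measurable_id measurable_snd) (sub_pos.2 hL₂') (sub_pos.2 hy1)]
    with K hKA hKB
  filter_upwards [(tendsto_id.atTop_mul_const (one_pos.trans hy1)).eventually hKA, hKB, hy]
    with t htA htB hty
  have hsplit : P.real {ω | K < Y ω ∧ t * y < A ω * Y ω} ≤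
      P.real {ω | K < |Y ω| ∧ t < A ω * Y ω + B ω} +
        P.real {ω | K < |Y ω| ∧ t * (y - 1) < |B ω|} := by
    refine (measureReal_mono fun ω hω => ?_).trans (measureReal_union_le _ _)
    have hKY : K < |Y ω| := hω.1.trans_le (le_abs_self _)
    rcases lt_or_ge t (A ω * Y ω + B ω) with hlt | hge
    · exact Or.inl ⟨hKY, hlt⟩
    · exact Or.inr ⟨hKY, by linarith [hω.2, neg_le_abs (B ω)]⟩
  simp only [id] at htA
  linarith

section RightTail

variable {C : ℝ} {g : Ω → ℝ} (hB : Measurable B) (hC : ∀ t, tail P Y t ≤ C * tail P A t)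
  (hfix : IdentDistrib (fun ω => A ω * Y ω + B ω) Y P P)
  (hg : ∀ᵐ ω ∂P, Tendsto
    (fun t => tail P (fun ω' => A ω' * Y ω + B ω') t / tail P A t) atTop (𝓝 (g ω)))
include hB hC hfix hg

theorem integrable_of_fixedPoint : Integrable g P := by
  have hg0 : 0 ≤ᵐ[P] g := hg.mono fun ω hω =>
    ge_of_tendsto' hω fun t => div_nonneg (tail_nonneg _ _) (tail_nonneg _ _)
  have hbounded := fun {K : ℝ} (hK : 0 < K) =>
    integrableOn_and_tendsto_measureReal_abs_le_and_lt_mul_add_div h.regular h.measurable h.pos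
      hB hc hY hYAB hg hK
  have hcover := (aecover_le (P := P) hY.norm).comp_tendsto
    (tendsto_atTop_add_const_right atTop 1 tendsto_natCast_atTop_atTop)
  refine hcover.integrable_of_integral_bounded_of_nonneg_ae C
    (fun n => (hbounded n.cast_add_one_pos).1) hg0 (Eventually.of_forall fun n => ?_)
  refine le_of_tendsto (hbounded n.cast_add_one_pos).2 (Eventually.of_forall fun t => ?_)
  calc P.real {ω | |Y ω| ≤ n + 1 ∧ t < A ω * Y ω + B ω} / tail P A t
      ≤ tail P Y t / tail P A t := by
        rw [tail_div_eq_of_fixedPoint hY hfix (n + 1) t]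
        exact le_add_of_nonneg_right (div_nonneg measureReal_nonneg (tail_nonneg _ _))
    _ ≤ C := (div_le_iff₀ (h.regular.tail_pos t)).2 (hC t)

theorem tendsto_tail_of_fixedPoint (hmom : ∫ ω, A ω ^ α ∂P < 1) :
    Tendsto (fun t => tail P Y t / tail P A t) atTop
      (𝓝 ((∫ ω, g ω ∂P) / (1 - ∫ ω, A ω ^ α ∂P))) := by
  have hFpos := h.regular.tail_pos
  have hbounded : ∀ U ∈ 𝓝 (∫ ω, g ω ∂P), ∀ᶠ K in atTop, ∀ᶠ t in atTop,
      P.real {ω | |Y ω| ≤ K ∧ t < A ω * Y ω + B ω} / tail P A t ∈ U := by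
    intro U hU
    have hlim := (aecover_le hY.norm).integral_tendsto_of_countably_generated
      (h.integrable_of_fixedPoint hc hY hYAB hB hC hfix hg)
    filter_upwards [hlim.eventually (eventually_mem_nhds_iff.2 hU), eventually_gt_atTop 0]
      with K hKU hK
    exact (integrableOn_and_tendsto_measureReal_abs_le_and_lt_mul_add_div h.regular h.measurable
      h.pos hB hc hY hYAB hg hK).2.eventually hKU
  refine tendsto_of_affine_improvement h.moment_pos.le hmom (c := 0) (C := C)
    (Eventually.of_forall fun t => div_nonneg (tail_nonneg _ _) (tail_nonneg _ _))
    (Eventually.of_forall fun t => (div_le_iff₀ (hFpos t)).2 (hC t))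
    (fun L L' hL hL' => ?_) (fun L L' hL hL' => ?_)
  · obtain ⟨M, hM, hM'⟩ := exists_between (lt_sub_iff_add_lt'.2 hL')
    obtain ⟨K, hKg, hKL⟩ := ((hbounded _ (Iio_mem_nhds (lt_sub_comm.1 hM'))).and
      (h.eventually_eventually_measureReal_lt_abs_and_lt_mul_add_le hc hY hYAB
        (hL.mono fun t => (div_le_iff₀ (hFpos t)).1) hM)).exists
    filter_upwards [hKg, hKL] with t htg htL
    rw [tail_div_eq_of_fixedPoint hY hfix K t]
    linarith [Set.mem_Iio.1 htg, (div_le_iff₀ (hFpos t)).2 htL]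
  · obtain ⟨M, hM', hM⟩ := exists_between (sub_lt_iff_lt_add'.2 hL')
    obtain ⟨K, hKg, hKL⟩ := ((hbounded _ (Ioi_mem_nhds (sub_lt_comm.1 hM'))).and
      (h.eventually_eventually_le_measureReal_lt_abs_and_lt_mul_add hc hY hYAB
        (hL.mono fun t => (le_div_iff₀ (hFpos t)).1) hM)).exists
    filter_upwards [hKg, hKL] with t htg htL
    rw [tail_div_eq_of_fixedPoint hY hfix K t]
    linarith [Set.mem_Ioi.1 htg, (le_div_iff₀ (hFpos t)).2 htL]

theorem integrable_and_tendsto_tail_of_fixedPoint (hmom : ∫ ω, A ω ^ α ∂P < 1) :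
    Integrable g P ∧ Tendsto (fun t => tail P Y t / tail P A t) atTop
      (𝓝 ((∫ ω, g ω ∂P) / (1 - ∫ ω, A ω ^ α ∂P))) :=
  ⟨h.integrable_of_fixedPoint hc hY hYAB hB hC hfix hg,
    h.tendsto_tail_of_fixedPoint hc hY hYAB hB hC hfix hg hmom⟩

end RightTail

theorem integrable_and_tendsto_leftTail_of_fixedPoint {C : ℝ} {g : Ω → ℝ} (hB : Measurable B)
    (hC : ∀ t, leftTail P Y t ≤ C * tail P A t)
    (hfix : IdentDistrib (fun ω => A ω * Y ω + B ω) Y P P)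
    (hg : ∀ᵐ ω ∂P, Tendsto
      (fun t => leftTail P (fun ω' => A ω' * Y ω + B ω') t / tail P A t) atTop (𝓝 (g ω)))
    (hmom : ∫ ω, A ω ^ α ∂P < 1) :
    Integrable g P ∧ Tendsto (fun t => leftTail P Y t / tail P A t) atTop
      (𝓝 ((∫ ω, g ω ∂P) / (1 - ∫ ω, A ω ^ α ∂P))) := by
  have hneg : ∀ a y b : ℝ, -(a * y + b) = a * -y + -b := fun a y b => by ring
  simp only [leftTail_eq_tail_neg, hneg] at hC hg ⊢
  have hc' : ∀ t, tail P (fun ω => |-B ω|) t ≤ c * tail P A t := by simpa only [abs_neg] using hc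
  have hYAB' : IndepFun (fun ω => -Y ω) (fun ω => (A ω, -B ω)) P :=
    hYAB.comp measurable_neg (measurable_fst.prodMk measurable_snd.neg)
  have hfix' : IdentDistrib (fun ω => A ω * -Y ω + -B ω) (fun ω => -Y ω) P P := by
    simpa only [Function.comp_def, hneg] using hfix.comp measurable_neg
  exact h.integrable_and_tendsto_tail_of_fixedPoint hc' hY.neg hYAB' hB.neg hC hfix' hg hmom

end IsConvolutionEquivalent

end FixedPoint

section UniformTailBound

variable {A A' B : Ω → ℝ} {α c : ℝ}

theorem tail_mul_add_le_add_add [IsFiniteMeasure P] (hpos : ∀ᵐ ω ∂P, 0 < A ω) (Y : Ω → ℝ)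
    {y K : ℝ} (hK : 0 < K) (t : ℝ) : tail P (fun ω => A ω * Y ω + B ω) t ≤
      P.real {ω | K < Y ω ∧ t * y < A ω * Y ω} + tail P A (t * (y / K)) +
        tail P B (t * (1 - y)) := by
  refine le_trans (ENNReal.toReal_mono (measure_ne_top _ _) (measure_mono_ae ?_))
    ((measureReal_union_le ({ω | K < Y ω ∧ t * y < A ω * Y ω} ∪ {ω | t * (y / K) < A ω}) _).trans
      (add_le_add_left (measureReal_union_le _ _) _))
  filter_upwards [hpos] with ω hω hlt
  have hlt : t < A ω * Y ω + B ω := hlt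
  by_cases hBt : t * (1 - y) < B ω
  · exact Or.inr hBt
  have hAY : t * y < A ω * Y ω := by linarith [not_lt.1 hBt]
  rcases lt_or_ge K (Y ω) with hKY | hYK
  · exact Or.inl (Or.inl ⟨hKY, hAY⟩)
  · refine Or.inl (Or.inr ?_)
    change t * (y / K) < A ω
    rw [← mul_div_assoc, div_lt_iff₀ hK]
    exact hAY.trans_le (mul_le_mul_of_nonneg_left hYK hω.le)

variable [IsProbabilityMeasure P]

theorem IsConvolutionEquivalent.exists_eventually_forall_tail_mul_add_le
    (h : IsConvolutionEquivalent P A A' α) (hmom : ∫ ω, A ω ^ α ∂P < 1)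
    (hc : ∀ t, tail P B t ≤ c * tail P A t) :
    ∃ θ ∈ Set.Ico (0 : ℝ) 1, ∃ D, ∀ᶠ t in atTop, ∀ (Y : Ω → ℝ) (C : ℝ), Measurable Y →
      IndepFun A Y P → (∀ s, tail P Y s ≤ C * tail P A s) →
        tail P (fun ω => A ω * Y ω + B ω) t ≤ (θ * C + D) * tail P A t := by
  have hFpos := h.regular.tail_pos
  have hc0 : 0 ≤ c := nonneg_of_mul_nonneg_left ((tail_nonneg _ 0).trans (hc 0)) (hFpos 0)
  obtain ⟨θ, hθ, hθ1⟩ := exists_between hmom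
  obtain ⟨r, hr, hrθ⟩ := exists_between hθ
  obtain ⟨y, ⟨hy0, hy1⟩, hy⟩ := h.regular.exists_lt_one_eventually_mul_tail_mul_le hrθ
  obtain ⟨K, hKr, hK⟩ := ((h.eventually_eventually_measureReal_div_mem (Iio_mem_nhds hr)).and
    (eventually_gt_atTop 0)).exists
  refine ⟨θ, ⟨(h.moment_pos.trans hθ).le, hθ1⟩,
    ((y / K) ^ (-α) + 1) + c * ((1 - y) ^ (-α) + 1), ?_⟩
  filter_upwards [(tendsto_id.atTop_mul_const hy0).eventually hKr, hy,
    (h.regular.tendsto_tail_mul_div (div_pos hy0 hK)).eventually_le_const (lt_add_one _),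
    (h.regular.tendsto_tail_mul_div (sub_pos.2 hy1)).eventually_le_const (lt_add_one _)]
    with t htr hty htA htB Y C hY hAY hC
  rw [div_le_iff₀ (hFpos t)] at htA htB
  have hC0 : 0 ≤ C := nonneg_of_mul_nonneg_left ((tail_nonneg _ 0).trans (hC 0)) (hFpos 0)
  have hcopy : ∀ s, 1 * tail P Y s ≤ C * tail P A' s := fun s => by
    rw [one_mul, tail_eq_of_identDistrib h.identDistrib]
    exact hC s
  have hlarge : P.real {ω | K < Y ω ∧ t * y < A ω * Y ω} ≤ C * (θ * tail P A t) :=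
    calc P.real {ω | K < Y ω ∧ t * y < A ω * Y ω}
        ≤ C * P.real {ω | K < A' ω ∧ t * y < A ω * A' ω} := by
          simpa only [one_mul] using mul_measureReal_lt_and_lt_mul_le_of_tail_le h.measurable
            h.pos hY hAY h.measurable_copy h.indepFun (c := 1) (C := C) (k := K)
            (fun s _ => hcopy s) (t * y)
      _ ≤ C * (r * tail P A (t * y)) :=
          mul_le_mul_of_nonneg_left ((div_le_iff₀ (hFpos _)).1 (le_of_lt htr)) hC0
      _ ≤ C * (θ * tail P A t) := mul_le_mul_of_nonneg_left hty hC0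
  linarith [tail_mul_add_le_add_add (B := B) h.pos Y (y := y) hK t, hc (t * (1 - y)),
    mul_le_mul_of_nonneg_left htB hc0]

theorem IsConvolutionEquivalent.exists_forall_tail_mul_add_le
    (h : IsConvolutionEquivalent P A A' α) (hmom : ∫ ω, A ω ^ α ∂P < 1)
    (hc : ∀ t, tail P B t ≤ c * tail P A t) :
    ∃ θ ∈ Set.Ico (0 : ℝ) 1, ∃ D, ∀ (Y : Ω → ℝ) (C : ℝ), Measurable Y →
      IndepFun A Y P → (∀ s, tail P Y s ≤ C * tail P A s) →
        ∀ t, tail P (fun ω => A ω * Y ω + B ω) t ≤ (θ * C + D) * tail P A t := by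
  have hFpos := h.regular.tail_pos
  obtain ⟨θ, hθ, D, hD⟩ := h.exists_eventually_forall_tail_mul_add_le hmom hc
  obtain ⟨T, hT⟩ := eventually_atTop.1 hD
  refine ⟨θ, hθ, max D (1 / tail P A T), fun Y C hY hAY hC t => ?_⟩
  have hC0 : 0 ≤ C := nonneg_of_mul_nonneg_left ((tail_nonneg _ 0).trans (hC 0)) (hFpos 0)
  rcases le_total T t with hTt | htT
  · exact (hT t hTt Y C hY hAY hC).trans (mul_le_mul_of_nonneg_right
      (add_le_add_right (le_max_left _ _) _) (hFpos t).le)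
  · calc tail P (fun ω => A ω * Y ω + B ω) t ≤ 1 := measureReal_le_one
      _ ≤ 1 / tail P A T * tail P A t := by
          rw [one_div_mul_eq_div, one_le_div (hFpos T)]
          exact tail_antitone A htT
      _ ≤ (θ * C + max D (1 / tail P A T)) * tail P A t :=
          mul_le_mul_of_nonneg_right ((le_max_right _ _).trans
            (le_add_of_nonneg_left (mul_nonneg hθ.1 hC0))) (hFpos t).le

end UniformTailBound

section Pathwise

variable {S : Type*} {A B : ℕ → S → ℝ} {X₀ : S → ℝ} {ω : S}

theorem perpetuityTerm_zero (A B : ℕ → S → ℝ) (ω : S) : perpetuityTerm A B 0 ω = B 0 ω :=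
  mul_one _

theorem perpetuityTerm_succ (A B : ℕ → S → ℝ) (k : ℕ) (ω : S) :
    perpetuityTerm A B (k + 1) ω =
      A 0 ω * perpetuityTerm (fun n => A (n + 1)) (fun n => B (n + 1)) k ω := by
  rw [perpetuityTerm, Finset.prod_range_succ', perpetuityTerm]
  ring

theorem sum_range_succ_perpetuityTerm (A B : ℕ → S → ℝ) (n : ℕ) (ω : S) :
    ∑ k ∈ Finset.range (n + 1), perpetuityTerm A B k ω =
      A 0 ω * (∑ k ∈ Finset.range n,
        perpetuityTerm (fun n => A (n + 1)) (fun n => B (n + 1)) k ω) + B 0 ω := by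
  rw [Finset.sum_range_succ', Finset.mul_sum]
  simp only [perpetuityTerm_succ, perpetuityTerm_zero]

theorem perpetuity_eq_mul_add (hω : Summable fun k => perpetuityTerm A B k ω) :
    perpetuity A B ω =
      A 0 ω * perpetuity (fun n => A (n + 1)) (fun n => B (n + 1)) ω + B 0 ω := by
  rw [perpetuity, hω.tsum_eq_zero_add, add_comm, perpetuityTerm_zero]
  simp only [perpetuityTerm_succ, tsum_mul_left, perpetuity]

theorem perpetuityTerm_abs (hω : ∀ n, 0 < A n ω) (k : ℕ) :
    perpetuityTerm A (fun n ω => |B n ω|) k ω = |perpetuityTerm A B k ω| := by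
  rw [perpetuityTerm, perpetuityTerm, abs_mul,
    abs_of_pos (Finset.prod_pos fun j _ => hω j : 0 < ∏ j ∈ Finset.range k, A j ω)]

theorem abs_perpetuity_le_of_sum_abs_le {t : ℝ}
    (h : ∀ n, ∑ k ∈ Finset.range n, |perpetuityTerm A B k ω| ≤ t) : |perpetuity A B ω| ≤ t :=
  (norm_tsum_le_tsum_norm (f := fun k => perpetuityTerm A B k ω)
    (summable_of_sum_range_le (fun _ => norm_nonneg _) h)).trans
    (Real.tsum_le_of_sum_range_le (fun _ => norm_nonneg _) h)

/-- The backward iteration: `n` steps of the chain from `X₀` with the vectors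
`(A 0, B 0), …, (A (n - 1), B (n - 1))` applied in reverse order, so that the input `(A 0, B 0)`
acts last. It has the law of the `n`-th state of the chain but converges pathwise. -/
def backward (A B : ℕ → S → ℝ) (X₀ : S → ℝ) (n : ℕ) (ω : S) : ℝ :=
  X₀ ω * ∏ j ∈ Finset.range n, A j ω + ∑ k ∈ Finset.range n, perpetuityTerm A B k ω

theorem backward_succ (A B : ℕ → S → ℝ) (X₀ : S → ℝ) (n : ℕ) (ω : S) :
    backward A B X₀ (n + 1) ω =
      A 0 ω * backward (fun n => A (n + 1)) (fun n => B (n + 1)) X₀ n ω + B 0 ω := by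
  rw [backward, sum_range_succ_perpetuityTerm, Finset.prod_range_succ', backward]
  ring

theorem chain_eq_backward_of_reverse {A' B' : ℕ → S → ℝ} {n : ℕ}
    (hA : ∀ j < n, A' j = A (n - 1 - j)) (hB : ∀ j < n, B' j = B (n - 1 - j)) :
    chain A B X₀ n = backward A' B' X₀ n := by
  induction n generalizing A' B' with
  | zero =>
    funext ω
    simp [chain, backward]
  | succ n ih =>
    have hshift : chain A B X₀ n = backward (fun j => A' (j + 1)) (fun j => B' (j + 1)) X₀ n := by
      refine ih (fun j hj => ?_) (fun j hj => ?_)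
      · rw [hA _ (Nat.succ_lt_succ hj), Nat.add_sub_cancel, Nat.sub_sub, Nat.add_comm]
      · rw [hB _ (Nat.succ_lt_succ hj), Nat.add_sub_cancel, Nat.sub_sub, Nat.add_comm]
    funext ω
    rw [backward_succ, hA 0 n.succ_pos, hB 0 n.succ_pos, ← hshift]
    rfl

end Pathwise

section Measurability

variable {A B : ℕ → Ω → ℝ} {X₀ : Ω → ℝ}

theorem measurable_perpetuityTerm (hA : ∀ n, Measurable (A n)) (hB : ∀ n, Measurable (B n))
    (k : ℕ) : Measurable (perpetuityTerm A B k) :=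
  (hB k).mul (Finset.measurable_fun_prod _ fun j _ => hA j)

theorem measurable_sum_perpetuityTerm (hA : ∀ n, Measurable (A n)) (hB : ∀ n, Measurable (B n))
    (n : ℕ) : Measurable fun ω => ∑ k ∈ Finset.range n, perpetuityTerm A B k ω :=
  Finset.measurable_fun_sum _ fun k _ => measurable_perpetuityTerm hA hB k

theorem measurable_perpetuity (hA : ∀ n, Measurable (A n)) (hB : ∀ n, Measurable (B n)) :
    Measurable (perpetuity A B) :=
  Measurable.tsum (measurable_perpetuityTerm hA hB)

theorem measurable_backward (hA : ∀ n, Measurable (A n)) (hB : ∀ n, Measurable (B n))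
    (hX₀ : Measurable X₀) (n : ℕ) : Measurable (backward A B X₀ n) :=
  (hX₀.mul (Finset.measurable_fun_prod _ fun j _ => hA j)).add
    (measurable_sum_perpetuityTerm hA hB n)

end Measurability

section IIDInput

/-- The random vectors `(A 0, B 0), (A 1, B 1), …` are independent and identically distributed;
no independence between `A n` and `B n` is assumed. -/
structure IsIIDInput (P : Measure Ω) (A B : ℕ → Ω → ℝ) : Prop where
  measurable_A : ∀ n, Measurable (A n)
  measurable_B : ∀ n, Measurable (B n)
  iIndepFun : iIndepFun (fun n ω => (A n ω, B n ω)) P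
  identDistrib : ∀ n, IdentDistrib (fun ω => (A n ω, B n ω)) (fun ω => (A 0 ω, B 0 ω)) P P

namespace IsIIDInput

variable {A B : ℕ → Ω → ℝ} {X₀ : Ω → ℝ}

theorem comp_snd (h : IsIIDInput P A B) {φ : ℝ → ℝ} (hφ : Measurable φ) :
    IsIIDInput P A fun n ω => φ (B n ω) where
  measurable_A := h.measurable_A
  measurable_B n := hφ.comp (h.measurable_B n)
  iIndepFun := h.iIndepFun.comp (fun _ => Prod.map id φ) fun _ => measurable_id.prodMap hφ
  identDistrib n := (h.identDistrib n).comp (measurable_id.prodMap hφ)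

theorem ae_forall_pos (h : IsIIDInput P A B) (hpos : ∀ᵐ ω ∂P, 0 < A 0 ω) :
    ∀ᵐ ω ∂P, ∀ n, 0 < A n ω :=
  ae_all_iff.2 fun n =>
    ((h.identDistrib n).comp measurable_fst).symm.ae_snd measurableSet_Ioi hpos

theorem indepFun_shift (h : IsIIDInput P A B) :
    IndepFun (fun ω => (A 0 ω, B 0 ω)) (fun ω n => (A (n + 1) ω, B (n + 1) ω)) P := by
  have hmeas : ∀ n, Measurable fun ω => (A n ω, B n ω) := fun n =>
    (h.measurable_A n).prodMk (h.measurable_B n)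
  have hsplit := indep_iSup_of_disjoint (fun n => (hmeas n).comap_le) h.iIndepFun
    (disjoint_compl_right : Disjoint ({0} : Set ℕ) {0}ᶜ)
  refine indep_of_indep_of_le_left (indep_of_indep_of_le_right hsplit ?_)
    (le_iSup₂_of_le 0 rfl le_rfl)
  rw [MeasurableSpace.pi, MeasurableSpace.comap_iSup]
  refine iSup_le fun n => ?_
  rw [MeasurableSpace.comap_comp]
  exact le_iSup₂_of_le (n + 1) n.succ_ne_zero le_rfl

theorem identDistrib_reindex (h : IsIIDInput P A B) {σ : ℕ → ℕ} (hσ : Function.Injective σ) :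
    IdentDistrib (fun ω n => (A (σ n) ω, B (σ n) ω)) (fun ω n => (A n ω, B n ω)) P P :=
  IdentDistrib.pi (fun n => (h.identDistrib (σ n)).trans (h.identDistrib n).symm)
    (h.iIndepFun.precomp hσ) h.iIndepFun

theorem identDistrib_sum_perpetuityTerm_shift (h : IsIIDInput P A B) (n : ℕ) :
    IdentDistrib (fun ω => ∑ k ∈ Finset.range n,
        perpetuityTerm (fun n => A (n + 1)) (fun n => B (n + 1)) k ω)
      (fun ω => ∑ k ∈ Finset.range n, perpetuityTerm A B k ω) P P :=
  (h.identDistrib_reindex (add_left_injective 1)).comp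
    (u := fun z => ∑ k ∈ Finset.range n,
      perpetuityTerm (fun j (z : ℕ → ℝ × ℝ) => (z j).1) (fun j z => (z j).2) k z)
    (measurable_sum_perpetuityTerm (fun j => (measurable_pi_apply j).fst)
      (fun j => (measurable_pi_apply j).snd) n)

theorem indepFun_sum_perpetuityTerm_shift (h : IsIIDInput P A B) (n : ℕ) :
    IndepFun (A 0) (fun ω => ∑ k ∈ Finset.range n,
      perpetuityTerm (fun n => A (n + 1)) (fun n => B (n + 1)) k ω) P :=
  h.indepFun_shift.comp measurable_fst
    (ψ := fun z => ∑ k ∈ Finset.range n,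
      perpetuityTerm (fun j (z : ℕ → ℝ × ℝ) => (z j).1) (fun j z => (z j).2) k z)
    (measurable_sum_perpetuityTerm (fun j => (measurable_pi_apply j).fst)
      (fun j => (measurable_pi_apply j).snd) n)

theorem identDistrib_perpetuity_shift (h : IsIIDInput P A B) :
    IdentDistrib (perpetuity (fun n => A (n + 1)) fun n => B (n + 1)) (perpetuity A B) P P :=
  (h.identDistrib_reindex (add_left_injective 1)).comp
    (u := perpetuity (fun j (z : ℕ → ℝ × ℝ) => (z j).1) fun j z => (z j).2)
    (measurable_perpetuity (fun j => (measurable_pi_apply j).fst)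
      fun j => (measurable_pi_apply j).snd)

theorem indepFun_perpetuity_shift (h : IsIIDInput P A B) :
    IndepFun (fun ω => (A 0 ω, B 0 ω)) (perpetuity (fun n => A (n + 1)) fun n => B (n + 1)) P :=
  h.indepFun_shift.comp measurable_id
    (ψ := perpetuity (fun j (z : ℕ → ℝ × ℝ) => (z j).1) fun j z => (z j).2)
    (measurable_perpetuity (fun j => (measurable_pi_apply j).fst)
      fun j => (measurable_pi_apply j).snd)

theorem identDistrib_mul_perpetuity_shift_add (h : IsIIDInput P A B)
    (hsum : ∀ᵐ ω ∂P, Summable fun k => perpetuityTerm A B k ω) :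
    IdentDistrib (fun ω => A 0 ω * perpetuity (fun n => A (n + 1)) (fun n => B (n + 1)) ω + B 0 ω)
      (perpetuity (fun n => A (n + 1)) fun n => B (n + 1)) P P :=
  (IdentDistrib.of_ae_eq (measurable_perpetuity h.measurable_A h.measurable_B).aemeasurable
    (hsum.mono fun _ hω => perpetuity_eq_mul_add hω)).symm.trans
    h.identDistrib_perpetuity_shift.symm

theorem ae_perpetuity_shift_mem_support (h : IsIIDInput P A B) :
    ∀ᵐ ω ∂P, perpetuity (fun n => A (n + 1)) (fun n => B (n + 1)) ω ∈
      (P.map (perpetuity A B)).support := by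
  rw [← h.identDistrib_perpetuity_shift.map_eq]
  exact ae_of_ae_map h.identDistrib_perpetuity_shift.aemeasurable_fst Measure.support_mem_ae

variable [IsProbabilityMeasure P]

theorem identDistrib_chain_backward (h : IsIIDInput P A B) (hX₀ : Measurable X₀)
    (hX₀indep : IndepFun X₀ (fun ω n => (A n ω, B n ω)) P) (n : ℕ) :
    IdentDistrib (chain A B X₀ n) (backward A B X₀ n) P P := by
  let σ : ℕ → ℕ := fun j => if j < n then n - 1 - j else j
  have hσ : Function.Injective σ := fun i j hij => by
    simp only [σ] at hij
    split_ifs at hij <;> omega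
  have hσ_of_lt : ∀ j < n, σ j = n - 1 - j := fun j hj => if_pos hj
  have hinput : IdentDistrib (fun ω => (X₀ ω, fun j => (A (σ j) ω, B (σ j) ω)))
      (fun ω => (X₀ ω, fun j => (A j ω, B j ω))) P P :=
    (IdentDistrib.refl hX₀.aemeasurable).prodMk (h.identDistrib_reindex hσ)
      (hX₀indep.comp (φ := id) (ψ := fun (z : ℕ → ℝ × ℝ) j => z (σ j)) measurable_id
        (measurable_pi_lambda _ fun j => measurable_pi_apply (σ j))) hX₀indep
  rw [chain_eq_backward_of_reverse (A' := fun j => A (σ j)) (B' := fun j => B (σ j))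
    (fun j hj => by rw [hσ_of_lt j hj]) fun j hj => by rw [hσ_of_lt j hj]]
  exact hinput.comp (measurable_backward (A := fun j (p : ℝ × (ℕ → ℝ × ℝ)) => (p.2 j).1)
    (B := fun j p => (p.2 j).2) (X₀ := Prod.fst) (fun j => by fun_prop) (fun j => by fun_prop)
    measurable_fst n)

theorem tendstoInDistribution_chain (h : IsIIDInput P A B) (hX₀ : Measurable X₀)
    (hX₀indep : IndepFun X₀ (fun ω n => (A n ω, B n ω)) P)
    (hsum : ∀ᵐ ω ∂P, Summable fun k => perpetuityTerm A B k ω)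
    (hprod : ∀ᵐ ω ∂P, Tendsto (fun n => ∏ j ∈ Finset.range n, A j ω) atTop (𝓝 0)) :
    TendstoInDistribution (chain A B X₀) atTop (perpetuity A B) (fun _ => P) P := by
  have hbackward :
      TendstoInDistribution (backward A B X₀) atTop (perpetuity A B) (fun _ => P) P := by
    refine tendstoInDistribution_of_ae_tendsto (fun n =>
        (measurable_backward h.measurable_A h.measurable_B hX₀ n).aemeasurable)
      (measurable_perpetuity h.measurable_A h.measurable_B).aemeasurable ?_
    filter_upwards [hsum, hprod] with ω hωsum hωprod
    have hlim := (hωprod.const_mul (X₀ ω)).add hωsum.hasSum.tendsto_sum_nat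
    rwa [mul_zero, zero_add] at hlim
  have hident := h.identDistrib_chain_backward hX₀ hX₀indep
  exact ⟨fun n => (hident n).aemeasurable_fst, hbackward.aemeasurable_limit,
    hbackward.tendsto.congr fun n => Subtype.ext (hident n).map_eq.symm⟩

end IsIIDInput

end IIDInput

section PerpetuityTail

namespace IsIIDInput

variable [IsProbabilityMeasure P] {A B : ℕ → Ω → ℝ} {α c : ℝ}

theorem exists_forall_tail_sum_perpetuityTerm_le (h : IsIIDInput P A B)
    (hA : IsConvolutionEquivalent P (A 0) (A 1) α) (hmom : ∫ ω, A 0 ω ^ α ∂P < 1)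
    (hc : ∀ t, tail P (B 0) t ≤ c * tail P (A 0) t) :
    ∃ C, ∀ n t, tail P (fun ω => ∑ k ∈ Finset.range n, perpetuityTerm A B k ω) t ≤
      C * tail P (A 0) t := by
  have hFpos := hA.regular.tail_pos
  obtain ⟨θ, ⟨-, hθ1⟩, D, hD⟩ := hA.exists_forall_tail_mul_add_le hmom hc
  obtain ⟨C₀, hC₀⟩ : ∃ C₀, ∀ t, tail P (fun _ => (0 : ℝ)) t ≤ C₀ * tail P (A 0) t := by
    refine exists_forall_tail_le_of_eventually_tail_le (c := 0) hFpos ?_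
    filter_upwards [eventually_ge_atTop 0] with t ht
    simp [tail, ht.not_gt]
  have hfix : θ * max C₀ (D / (1 - θ)) + D ≤ max C₀ (D / (1 - θ)) := by
    have := (div_le_iff₀ (sub_pos.2 hθ1)).1 (le_max_right C₀ (D / (1 - θ)))
    linarith
  refine ⟨max C₀ (D / (1 - θ)), fun n => ?_⟩
  induction n with
  | zero =>
    intro t
    simpa only [Finset.sum_range_zero] using
      (hC₀ t).trans (mul_le_mul_of_nonneg_right (le_max_left _ _) (hFpos t).le)
  | succ n ih =>
    intro t
    simp only [sum_range_succ_perpetuityTerm]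
    refine (hD _ _ (measurable_sum_perpetuityTerm (fun n => h.measurable_A (n + 1))
      (fun n => h.measurable_B (n + 1)) n) (h.indepFun_sum_perpetuityTerm_shift n)
      (fun s => ?_) t).trans (mul_le_mul_of_nonneg_right hfix (hFpos t).le)
    rw [tail_eq_of_identDistrib (h.identDistrib_sum_perpetuityTerm_shift n)]
    exact ih s

theorem exists_forall_measureReal_exists_lt_sum_abs_le (h : IsIIDInput P A B)
    (hA : IsConvolutionEquivalent P (A 0) (A 1) α) (hmom : ∫ ω, A 0 ω ^ α ∂P < 1)
    (hc : ∀ t, tail P (fun ω => |B 0 ω|) t ≤ c * tail P (A 0) t) :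
    ∃ C, ∀ t, P.real {ω | ∃ n, t < ∑ k ∈ Finset.range n, |perpetuityTerm A B k ω|} ≤
      C * tail P (A 0) t := by
  obtain ⟨C, hC⟩ :=
    (h.comp_snd measurable_abs).exists_forall_tail_sum_perpetuityTerm_le hA hmom hc
  have hCabs : ∀ n t, P.real {ω | t < ∑ k ∈ Finset.range n, |perpetuityTerm A B k ω|} ≤
      C * tail P (A 0) t := fun n t => by
    have hle : (fun ω => ∑ k ∈ Finset.range n, |perpetuityTerm A B k ω|) ≤ᵐ[P]
        fun ω => ∑ k ∈ Finset.range n, perpetuityTerm A (fun n ω => |B n ω|) k ω := by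
      filter_upwards [h.ae_forall_pos hA.pos] with ω hω
      simp only [perpetuityTerm_abs hω, le_refl]
    exact (tail_mono_of_ae_le hle t).trans (hC n t)
  refine ⟨C, fun t => ?_⟩
  have hmono : Monotone fun n => {ω | t < ∑ k ∈ Finset.range n, |perpetuityTerm A B k ω|} :=
    fun m n hmn ω (hω : t < ∑ k ∈ Finset.range m, |perpetuityTerm A B k ω|) =>
      hω.trans_le (Finset.sum_le_sum_of_subset_of_nonneg (Finset.range_mono hmn)
        fun _ _ _ => abs_nonneg _)
  rw [Set.ofPred_exists]
  exact le_of_tendsto' ((ENNReal.tendsto_toReal (measure_ne_top P _)).comp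
    (tendsto_measure_iUnion_atTop hmono)) fun n => hCabs n t

theorem ae_summable_abs_perpetuityTerm (h : IsIIDInput P A B)
    (hA : IsConvolutionEquivalent P (A 0) (A 1) α) (hmom : ∫ ω, A 0 ω ^ α ∂P < 1)
    (hc : ∀ t, tail P (fun ω => |B 0 ω|) t ≤ c * tail P (A 0) t) :
    ∀ᵐ ω ∂P, Summable fun k => |perpetuityTerm A B k ω| := by
  obtain ⟨C, hC⟩ := h.exists_forall_measureReal_exists_lt_sum_abs_le hA hmom hc
  have hlim : Tendsto (fun t => C * tail P (A 0) t) atTop (𝓝 0) := by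
    simpa only [mul_zero] using (tendsto_tail_atTop hA.measurable).const_mul C
  have hunbounded : P.real {ω | ∀ t : ℝ, ∃ n,
      t < ∑ k ∈ Finset.range n, |perpetuityTerm A B k ω|} = 0 :=
    le_antisymm (ge_of_tendsto' hlim fun t =>
      (measureReal_mono (Set.ofPred_subset_ofPred.2 fun _ hω => hω t)).trans (hC t))
      measureReal_nonneg
  have hbounded : ∀ᵐ ω ∂P, ¬ ∀ t : ℝ, ∃ n,
      t < ∑ k ∈ Finset.range n, |perpetuityTerm A B k ω| :=
    measure_eq_zero_iff_ae_notMem.1 ((measureReal_eq_zero_iff).1 hunbounded)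
  filter_upwards [hbounded] with ω hω
  push Not at hω
  obtain ⟨t, ht⟩ := hω
  exact summable_of_sum_range_le (fun _ => abs_nonneg _) ht

theorem ae_summable_perpetuityTerm (h : IsIIDInput P A B)
    (hA : IsConvolutionEquivalent P (A 0) (A 1) α) (hmom : ∫ ω, A 0 ω ^ α ∂P < 1)
    (hc : ∀ t, tail P (fun ω => |B 0 ω|) t ≤ c * tail P (A 0) t) :
    ∀ᵐ ω ∂P, Summable fun k => perpetuityTerm A B k ω :=
  (h.ae_summable_abs_perpetuityTerm hA hmom hc).mono fun _ hω => hω.of_abs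

-- The products are the terms of the perpetuity with `B = 1`.
theorem ae_tendsto_prod_zero (h : IsIIDInput P A B)
    (hA : IsConvolutionEquivalent P (A 0) (A 1) α) (hmom : ∫ ω, A 0 ω ^ α ∂P < 1) :
    ∀ᵐ ω ∂P, Tendsto (fun n => ∏ j ∈ Finset.range n, A j ω) atTop (𝓝 0) := by
  obtain ⟨c, hc⟩ : ∃ c, ∀ t, tail P (fun _ => |(1 : ℝ)|) t ≤ c * tail P (A 0) t := by
    refine exists_forall_tail_le_of_eventually_tail_le (c := 0) hA.regular.tail_pos ?_
    filter_upwards [eventually_ge_atTop 1] with t ht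
    simp [tail, ht.not_gt]
  filter_upwards [(h.comp_snd (measurable_const (a := (1 : ℝ)))).ae_summable_perpetuityTerm
    hA hmom hc] with ω hω
  simpa only [perpetuityTerm, one_mul] using hω.tendsto_atTop_zero

theorem map_perpetuity (h : IsIIDInput P A B)
    (hsum : ∀ᵐ ω ∂P, Summable fun k => perpetuityTerm A B k ω) :
    P.map (perpetuity A B) =
      ((P.map fun ω => (A 0 ω, B 0 ω)).prod (P.map (perpetuity A B))).map
        fun z => z.1.1 * z.2 + z.1.2 := by
  have hinput : Measurable fun ω => (A 0 ω, B 0 ω) :=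
    (h.measurable_A 0).prodMk (h.measurable_B 0)
  have hshift : Measurable (perpetuity (fun n => A (n + 1)) fun n => B (n + 1)) :=
    measurable_perpetuity (fun n => h.measurable_A (n + 1)) fun n => h.measurable_B (n + 1)
  have hjoint := (indepFun_iff_map_prod_eq_prod_map_map hinput.aemeasurable
    hshift.aemeasurable).1 h.indepFun_perpetuity_shift
  rw [h.identDistrib_perpetuity_shift.map_eq] at hjoint
  rw [← hjoint, Measure.map_map (by fun_prop) (hinput.prodMk hshift)]
  exact Measure.map_congr (hsum.mono fun _ hω => perpetuity_eq_mul_add hω)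

theorem exists_forall_tail_abs_perpetuity_shift_le (h : IsIIDInput P A B)
    (hA : IsConvolutionEquivalent P (A 0) (A 1) α) (hmom : ∫ ω, A 0 ω ^ α ∂P < 1)
    (hc : ∀ t, tail P (fun ω => |B 0 ω|) t ≤ c * tail P (A 0) t) :
    ∃ C, ∀ t, tail P (fun ω => |perpetuity (fun n => A (n + 1)) (fun n => B (n + 1)) ω|) t ≤
      C * tail P (A 0) t := by
  obtain ⟨C, hC⟩ := h.exists_forall_measureReal_exists_lt_sum_abs_le hA hmom hc
  refine ⟨C, fun t => ?_⟩
  have habs : IdentDistrib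
      (fun ω => |perpetuity (fun n => A (n + 1)) (fun n => B (n + 1)) ω|)
      (fun ω => |perpetuity A B ω|) P P := h.identDistrib_perpetuity_shift.comp measurable_abs
  rw [tail_eq_of_identDistrib habs]
  refine (measureReal_mono fun ω (hω : t < |perpetuity A B ω|) => ?_).trans (hC t)
  by_contra hle
  exact hω.not_ge (abs_perpetuity_le_of_sum_abs_le fun n => not_lt.1 fun hlt => hle ⟨n, hlt⟩)

theorem integrable_and_tendsto_tail_perpetuity (h : IsIIDInput P A B)
    (hA : IsConvolutionEquivalent P (A 0) (A 1) α) (hmom : ∫ ω, A 0 ω ^ α ∂P < 1)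
    (hc : ∀ t, tail P (fun ω => |B 0 ω|) t ≤ c * tail P (A 0) t) {f : ℝ → ℝ} (hf : Measurable f)
    (hlim : ∀ y ∈ (P.map (perpetuity A B)).support,
      Tendsto (fun t => tail P (fun ω => A 0 ω * y + B 0 ω) t / tail P (A 0) t) atTop
        (𝓝 (f y))) :
    Integrable (fun ω => f (perpetuity A B ω)) P ∧
      Tendsto (fun t => tail P (perpetuity A B) t / tail P (A 0) t) atTop
        (𝓝 ((∫ ω, f (perpetuity A B ω) ∂P) / (1 - ∫ ω, A 0 ω ^ α ∂P))) := by
  have hident := h.identDistrib_perpetuity_shift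
  have hident_f : IdentDistrib
      (fun ω => f (perpetuity (fun n => A (n + 1)) (fun n => B (n + 1)) ω))
      (fun ω => f (perpetuity A B ω)) P P := hident.comp hf
  obtain ⟨C, hC⟩ := h.exists_forall_tail_abs_perpetuity_shift_le hA hmom hc
  have hY := measurable_perpetuity (fun n => h.measurable_A (n + 1)) fun n =>
    h.measurable_B (n + 1)
  have hfix := h.identDistrib_mul_perpetuity_shift_add (h.ae_summable_perpetuityTerm hA hmom hc)
  have hg := h.ae_perpetuity_shift_mem_support.mono fun ω hω => hlim _ hω
  obtain ⟨hint, htail⟩ := hA.integrable_and_tendsto_tail_of_fixedPoint hc hY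
    h.indepFun_perpetuity_shift.symm (h.measurable_B 0)
    (fun t => (tail_le_tail_abs _ t).trans (hC t)) hfix hg hmom
  simp only [tail_eq_of_identDistrib hident, hident_f.integral_eq] at htail
  exact ⟨hident_f.integrable_iff.1 hint, htail⟩

theorem integrable_and_tendsto_leftTail_perpetuity (h : IsIIDInput P A B)
    (hA : IsConvolutionEquivalent P (A 0) (A 1) α) (hmom : ∫ ω, A 0 ω ^ α ∂P < 1)
    (hc : ∀ t, tail P (fun ω => |B 0 ω|) t ≤ c * tail P (A 0) t) {f : ℝ → ℝ} (hf : Measurable f)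
    (hlim : ∀ y ∈ (P.map (perpetuity A B)).support,
      Tendsto (fun t => leftTail P (fun ω => A 0 ω * y + B 0 ω) t / tail P (A 0) t) atTop
        (𝓝 (f y))) :
    Integrable (fun ω => f (perpetuity A B ω)) P ∧
      Tendsto (fun t => leftTail P (perpetuity A B) t / tail P (A 0) t) atTop
        (𝓝 ((∫ ω, f (perpetuity A B ω) ∂P) / (1 - ∫ ω, A 0 ω ^ α ∂P))) := by
  have hident := h.identDistrib_perpetuity_shift
  have hident_f : IdentDistrib
      (fun ω => f (perpetuity (fun n => A (n + 1)) (fun n => B (n + 1)) ω))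
      (fun ω => f (perpetuity A B ω)) P P := hident.comp hf
  obtain ⟨C, hC⟩ := h.exists_forall_tail_abs_perpetuity_shift_le hA hmom hc
  have hY := measurable_perpetuity (fun n => h.measurable_A (n + 1)) fun n =>
    h.measurable_B (n + 1)
  have hfix := h.identDistrib_mul_perpetuity_shift_add (h.ae_summable_perpetuityTerm hA hmom hc)
  have hg := h.ae_perpetuity_shift_mem_support.mono fun ω hω => hlim _ hω
  obtain ⟨hint, htail⟩ := hA.integrable_and_tendsto_leftTail_of_fixedPoint hc hY
    h.indepFun_perpetuity_shift.symm (h.measurable_B 0)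
    (fun t => (leftTail_le_tail_abs _ t).trans (hC t)) hfix hg hmom
  simp only [leftTail_eq_of_identDistrib hident, hident_f.integral_eq] at htail
  exact ⟨hident_f.integrable_iff.1 hint, htail⟩

end IsIIDInput

end PerpetuityTail

end RandomDifference

theorem mainTheorem2 {Ω : Type*} [MeasurableSpace Ω] (P : Measure Ω) [IsProbabilityMeasure P]
    -- an i.i.d. sequence of random vectors `(A n, B n)`, with generic element `(A 0, B 0)`
    (A B : ℕ → Ω → ℝ) (hA : ∀ n, Measurable (A n)) (hB : ∀ n, Measurable (B n))
    (hindep : iIndepFun (fun n ω => (A n ω, B n ω)) P)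
    (hident : ∀ n, IdentDistrib (fun ω => (A n ω, B n ω)) (fun ω => (A 0 ω, B 0 ω)) P P)
    (hpos : ∀ᵐ ω ∂P, 0 < A 0 ω)
    -- the initial value of the chain, independent of the sequence
    (X₀ : Ω → ℝ) (hX₀ : Measurable X₀)
    (hX₀indep : IndepFun X₀ (fun ω n => (A n ω, B n ω)) P)
    -- regular variation, the convolution condition and the moment condition
    (α : ℝ) (hα : 0 < α)
    (hreg : ∀ y : ℝ, 0 < y → RandomDifference.TailEquiv
      (fun t => RandomDifference.tail P (A 0) (t * y))
      (fun t => y ^ (-α) * RandomDifference.tail P (A 0) t))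
    (hint : Integrable (fun ω => A 0 ω ^ α) P)
    (hconv : RandomDifference.TailEquiv
      (fun t => RandomDifference.tail P (fun ω => A 0 ω * A 1 ω) t)
      (fun t => 2 * (∫ ω, A 0 ω ^ α ∂P) * RandomDifference.tail P (A 0) t))
    (hmom : ∫ ω, A 0 ω ^ α ∂P < 1)
    -- the tail of `|B|` is at most of the order of that of `A`
    (htailB : limsup (fun t : ℝ => P {ω | t < |B 0 ω|} / P {ω | t < A 0 ω}) atTop < ⊤)
    -- the tails of `A y + B` for `y` in the support of the law of the perpetuity
    (fplus fminus : ℝ → ℝ) (hfp : Measurable fplus) (hfm : Measurable fminus)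
    (hfp0 : ∀ y, 0 ≤ fplus y) (hfm0 : ∀ y, 0 ≤ fminus y)
    (hplus : ∀ y ∈ (P.map (RandomDifference.perpetuity A B)).support,
      Tendsto (fun t => RandomDifference.tail P (fun ω => A 0 ω * y + B 0 ω) t /
        RandomDifference.tail P (A 0) t) atTop (𝓝 (fplus y)))
    (hminus : ∀ y ∈ (P.map (RandomDifference.perpetuity A B)).support,
      Tendsto (fun t => RandomDifference.leftTail P (fun ω => A 0 ω * y + B 0 ω) t /
        RandomDifference.tail P (A 0) t) atTop (𝓝 (fminus y))) :
    -- the perpetuity converges and its law solves `X = A X + B` in distribution,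
    -- with `X` independent of `(A, B)`
    (∀ᵐ ω ∂P, Summable (fun k => RandomDifference.perpetuityTerm A B k ω)) ∧
    IdentDistrib (RandomDifference.perpetuity A B)
      (fun z : (ℝ × ℝ) × ℝ => z.1.1 * z.2 + z.1.2) P
      ((P.map (fun ω => (A 0 ω, B 0 ω))).prod (P.map (RandomDifference.perpetuity A B))) ∧
    -- weak convergence of the chain
    TendstoInDistribution (RandomDifference.chain A B X₀) atTop
      (RandomDifference.perpetuity A B) (fun _ => P) P ∧
    -- the right tail
    Integrable (fun ω => fplus (RandomDifference.perpetuity A B ω)) P ∧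
    Tendsto (fun t => RandomDifference.tail P (RandomDifference.perpetuity A B) t /
        RandomDifference.tail P (A 0) t) atTop
      (𝓝 ((∫ ω, fplus (RandomDifference.perpetuity A B ω) ∂P) / (1 - ∫ ω, A 0 ω ^ α ∂P))) ∧
    -- the left tail
    Integrable (fun ω => fminus (RandomDifference.perpetuity A B ω)) P ∧
    Tendsto (fun t => RandomDifference.leftTail P (RandomDifference.perpetuity A B) t /
        RandomDifference.tail P (A 0) t) atTop
      (𝓝 ((∫ ω, fminus (RandomDifference.perpetuity A B ω) ∂P) /
        (1 - ∫ ω, A 0 ω ^ α ∂P))) := by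
  have h : RandomDifference.IsIIDInput P A B := ⟨hA, hB, hindep, hident⟩
  have hconvEquiv : RandomDifference.IsConvolutionEquivalent P (A 0) (A 1) α :=
    ⟨hA 0, hA 1, (hindep.indepFun zero_ne_one).comp measurable_fst measurable_fst,
      (hident 1).comp measurable_fst, hpos, hreg, hint, hconv⟩
  obtain ⟨c, hc⟩ :=
    RandomDifference.exists_forall_tail_le_of_limsup_lt_top hconvEquiv.regular.tail_pos htailB
  have hsum := h.ae_summable_perpetuityTerm hconvEquiv hmom hc
  have hprod := h.ae_tendsto_prod_zero hconvEquiv hmom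
  obtain ⟨hplus_int, hplus_lim⟩ :=
    h.integrable_and_tendsto_tail_perpetuity hconvEquiv hmom hc hfp hplus
  obtain ⟨hminus_int, hminus_lim⟩ :=
    h.integrable_and_tendsto_leftTail_perpetuity hconvEquiv hmom hc hfm hminus
  have hfixedPoint : IdentDistrib (RandomDifference.perpetuity A B)
      (fun z : (ℝ × ℝ) × ℝ => z.1.1 * z.2 + z.1.2) P
      ((P.map fun ω => (A 0 ω, B 0 ω)).prod (P.map (RandomDifference.perpetuity A B))) :=
    ⟨(RandomDifference.measurable_perpetuity hA hB).aemeasurable, by fun_prop,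
      h.map_perpetuity hsum⟩
  exact ⟨hsum, hfixedPoint, h.tendstoInDistribution_chain hX₀ hX₀indep hsum hprod,
    hplus_int, hplus_lim, hminus_int, hminus_lim⟩
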